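/- Let $n\ge 1$ be an integer, $\Omega>0$ and $\gamma>0$, and put $s_\gamma=\sinh\gamma$, $c_\gamma=\cosh\gamma$. Let either $\theta=\ln\frac{\Omega}{2s_\gamma}$ (missed detection case) or $\theta=\ln\frac{\Omega}{2s_\gamma}-\ln(1+\Omega)$ (false alarm case), and let $\alpha(z)=c_\gamma-\cosh z+s_\gamma(z-\gamma)$ for complex $z$. With principal logarithm and square root, consider $t^{-1}(x)=\operatorname{sign}(\Im x)\sqrt{2\alpha(\ln x)}$ on the set of those complex $x\neq0$ for which $\alpha(\ln x)$ is real and nonnegative. Define $$g(\gamma)=\frac1\pi\int_0^\infty \Im[f(u)]\,e^{-nu^2/(4s_\gamma)}\,du,\qquad f(u)=\frac{t'(u)}{e^{\theta}-t(u)},$$ where $t$ is the inverse function of $t^{-1}$. Then $t^{-1}$ is a bijection of that set onto $\mathbb R$, so that $t:\mathbb R\to\mathbb C$ is well defined; $t$ is differentiable on $(0,\infty)$; the integral defining $g(\gamma)$ converges absolutely; and $$g(\gamma)=\frac1\pi\int_0^\pi \tilde g(\phi)\,e^{-nu(\phi)^2/(4s_\gamma)}\,d\phi ,$$ where the integral on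 the right also converges absolutely, and where $$\tilde g(\phi)=\frac{e^{\theta-r(\phi)}\,[\cos\phi+r'(\phi)\sin\phi]-1}{e^{2(\theta-r(\phi))}-2\cos(\phi)\,e^{\theta-r(\phi)}+1},\qquad r(\phi)=\operatorname{asinh}\!\Big(\frac{s_\gamma}{\operatorname{sinc}\phi}\Big),\quad \operatorname{sinc}\phi=\frac{\sin\phi}{\phi},$$ $$r'(\phi)=\frac{1/\phi-\cot\phi}{\sqrt{1+\operatorname{sinc}^2(\phi)/s_\gamma^2}},\qquad u(\phi)=\sqrt{2h(\phi)},\qquad h(\phi)=(1-\cos\phi)\cosh(r(\phi))+\alpha(r(\phi)).$$ Here the displayed $r'$ is the derivative of $r$ on $(0,\pi)$, and $h\ge0$ on $[0,\pi)$. -/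

import Mathlib

namespace AWGNConverse

noncomputable section

/-- The two error probabilities of the binary hypothesis test:
missed detection (MD) and false alarm (FA). -/
inductive ErrorKind where
  | MD
  | FA

/-- The parameter `θ(γ) = ln (Ω / (2 sinh γ))`, shifted by `- ln (1 + Ω)` in the FA case. -/
def theta (Ω : ℝ) (k : ErrorKind) (γ : ℝ) : ℝ :=
  Real.log (Ω / (2 * Real.sinh γ)) +
    match k with
    | ErrorKind.MD => 0
    | ErrorKind.FA => - Real.log (1 + Ω)

/-- The function `α(z) = cosh γ - cosh z + sinh γ (z - γ)` of a complex variable. -/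
def alphaC (γ : ℝ) (z : ℂ) : ℂ :=
  (Real.cosh γ : ℂ) - Complex.cosh z + (Real.sinh γ : ℂ) * (z - (γ : ℂ))

/-- The function `α` on the real line. -/
def alpha (γ x : ℝ) : ℝ :=
  Real.cosh γ - Real.cosh x + Real.sinh γ * (x - γ)

theorem alphaC_ofReal (γ x : ℝ) : alphaC γ (x : ℂ) = (alpha γ x : ℂ) := by
  simp [alphaC, alpha]

/-- The function `t⁻¹(x) = sign (Im x) √(2 α (ln x))`, with the principal branches of
the logarithm and of the square root. -/
def tInv (γ : ℝ) (x : ℂ) : ℂ :=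
  (Real.sign x.im : ℂ) * Complex.sqrt (2 * alphaC γ (Complex.log x))

/-- The path on which `t` takes its values: the nonzero complex numbers `x` for which
`α (ln x)` is real and nonnegative, that is, for which `√(2 α (ln x))` is real. -/
def path (γ : ℝ) : Set ℂ :=
  {x | x ≠ 0 ∧ (alphaC γ (Complex.log x)).im = 0 ∧ 0 ≤ (alphaC γ (Complex.log x)).re}

/-- The function `t` of a real variable, the inverse of `t⁻¹` on the path. -/
def t (γ u : ℝ) : ℂ :=
  Function.invFunOn (tInv γ) (path γ) (u : ℂ)

/-- `f(u) = t'(u) / (e^θ - t(u))`. -/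
def f (Ω : ℝ) (k : ErrorKind) (γ u : ℝ) : ℂ :=
  deriv (t γ) u / ((Real.exp (theta Ω k γ) : ℂ) - t γ u)

/-- The integrand `Im (f(u)) exp (- n u² / (4 sinh γ))`. -/
def gIntegrand (n : ℕ) (Ω : ℝ) (k : ErrorKind) (γ u : ℝ) : ℝ :=
  (f Ω k γ u).im * Real.exp (-((n : ℝ) * u ^ 2) / (4 * Real.sinh γ))

/-- `g(γ) = (1/π) ∫₀^∞ Im (f(u)) exp (- n u² / (4 sinh γ)) du`. -/
def g (n : ℕ) (Ω : ℝ) (k : ErrorKind) (γ : ℝ) : ℝ :=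
  1 / Real.pi * ∫ u in Set.Ioi (0 : ℝ), gIntegrand n Ω k γ u

/-- `r(φ) = asinh (sinh γ / sinc φ)`. -/
def r (γ φ : ℝ) : ℝ :=
  Real.arsinh (Real.sinh γ / Real.sinc φ)

/-- The explicit expression of the derivative of `r`. -/
def rPrime (γ φ : ℝ) : ℝ :=
  (1 / φ - Real.cot φ) / Real.sqrt (1 + Real.sinc φ ^ 2 / Real.sinh γ ^ 2)

/-- `h(φ) = (1 - cos φ) cosh (r(φ)) + α(r(φ))`. -/
def h (γ φ : ℝ) : ℝ :=
  (1 - Real.cos φ) * Real.cosh (r γ φ) + alpha γ (r γ φ)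

/-- `u(φ) = √(2 h(φ))`. -/
def uPhi (γ φ : ℝ) : ℝ :=
  Real.sqrt (2 * h γ φ)

/-- The function `g̃(φ)`. -/
def gTilde (Ω : ℝ) (k : ErrorKind) (γ φ : ℝ) : ℝ :=
  (Real.exp (theta Ω k γ - r γ φ) * (Real.cos φ + rPrime γ φ * Real.sin φ) - 1) /
    (Real.exp (2 * (theta Ω k γ - r γ φ))
      - 2 * Real.cos φ * Real.exp (theta Ω k γ - r γ φ) + 1)

/-- The integrand `g̃(φ) exp (- n u(φ)² / (4 sinh γ))`. -/
def gTildeIntegrand (n : ℕ) (Ω : ℝ) (k : ErrorKind) (γ φ : ℝ) : ℝ :=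
  gTilde Ω k γ φ * Real.exp (-((n : ℝ) * uPhi γ φ ^ 2) / (4 * Real.sinh γ))

end

end AWGNConverse

/-!
The condition that `α(ln x)` be real confines `x = e^{a + iφ}` to the curve
`sinh a = sinh γ / sinc φ`, or to the positive half-line `φ = 0`, where `α ≤ 0` with equality at
`a = γ` only. So the path is the curve `φ ↦ e^{r(φ) + iφ}` for `φ ∈ (-π, π)` (`path_eq_image`),
and `α(ln x) = h(φ)` on it. The function `h` is even, increases strictly from `h(0) = 0`
(`hPrime_pos`, a consequence of `φ cos φ < sin φ`) and tends to infinity at `π` (`tendsto_h`). In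
the coordinate `φ`, the map `t⁻¹` is therefore the odd extension of `u(φ) = √(2 h(φ))`, a strictly
increasing bijection of `(-π, π)` onto `ℝ` (`existsUnique_tInv_eq`). Since `u' > 0` on `(0, π)`,
its inverse is differentiable there, and so is `t` (`hasDerivAt_t`).

The formula for `g` is the substitution `u = u(φ)`. As `t(u(φ)) = e^{r(φ) + iφ}`, it turns
`Im f(u) du` into `Im ((r' + i) e^{r + iφ} / (e^θ - e^{r + iφ})) dφ = g̃(φ) dφ`
(`im_point_div`). The change of variables also transports integrability, so both integrals converge
absolutely once `g̃` is bounded on `(0, π)` (`exists_gTilde_le`). Its denominator is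
`|e^{θ - r} - e^{iφ}|²`, which is at least `1` for `φ ≥ π / 2`, and is bounded away from `0` on
`[0, π / 2]` unless `θ = γ`. In this last case, `e^θ` is the point `t(0)` of the path, and `g̃`
stays bounded because numerator and denominator both vanish to second order at `φ = 0`.
-/

namespace AWGNConverse

open Real Set Filter Topology MeasureTheory

variable {γ φ : ℝ}

/-! ### The angle `φ` and the radius `r(φ)` -/

theorem mul_cos_lt_sin (hφ : φ ∈ Ioo 0 π) : φ * cos φ < sin φ := by
  have hs := sin_pos_of_mem_Ioo hφ
  rcases lt_or_ge φ (π / 2) with h2 | h2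
  · have hc := cos_pos_of_mem_Ioo ⟨by linarith [hφ.1], h2⟩
    have := lt_tan hφ.1 h2
    rwa [tan_eq_sin_div_cos, lt_div_iff₀ hc] at this
  · have hc := cos_nonpos_of_pi_div_two_le_of_le h2 (by linarith [hφ.2, pi_pos])
    nlinarith [hφ.1]

theorem sinc_pos (hφ : φ ∈ Ioo (-π) π) : 0 < sinc φ := by
  rcases lt_trichotomy φ 0 with h | rfl | h
  · rw [← sinc_neg, sinc_of_ne_zero (by linarith)]
    exact div_pos (sin_pos_of_mem_Ioo ⟨by linarith, by linarith [hφ.1]⟩) (by linarith)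
  · simp
  · rw [sinc_of_ne_zero h.ne']
    exact div_pos (sin_pos_of_mem_Ioo ⟨h, hφ.2⟩) h

theorem sinh_r (γ φ : ℝ) : sinh (r γ φ) = sinh γ / sinc φ := sinh_arsinh _

theorem r_neg (γ φ : ℝ) : r γ (-φ) = r γ φ := by simp [r]

theorem r_zero (γ : ℝ) : r γ 0 = γ := by simp [r]

/-- The imaginary part of `α(r(φ) + iφ)` vanishes. -/
theorem sinh_r_mul_sin (γ : ℝ) (hφ : φ ∈ Ioo (-π) π) :
    sinh (r γ φ) * sin φ = sinh γ * φ := by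
  rw [sinh_r]
  rcases eq_or_ne φ 0 with rfl | h
  · simp
  · have := (sinc_pos hφ).ne'
    rw [div_mul_eq_mul_div, div_eq_iff this, sinc_of_ne_zero h]
    field_simp

theorem le_r (hγ : 0 < γ) (hφ : φ ∈ Ioo (-π) π) : γ ≤ r γ φ := by
  have := sinc_pos hφ
  rw [← sinh_le_sinh, sinh_r, le_div_iff₀ this]
  nlinarith [sinc_le_one φ, sinh_pos_iff.2 hγ]

theorem continuousOn_r (γ : ℝ) : ContinuousOn (r γ) (Ioo (-π) π) := by
  unfold r
  exact (continuousOn_const.div continuous_sinc.continuousOn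
    fun φ hφ ↦ (sinc_pos hφ).ne').arsinh

theorem hasDerivAt_r (hγ : 0 < γ) (hφ : φ ∈ Ioo 0 π) :
    HasDerivAt (r γ) (rPrime γ φ) φ := by
  have hs := sin_pos_of_mem_Ioo hφ
  have hγ' := sinh_pos_iff.2 hγ
  have h0 := hφ.1
  have hd : HasDerivAt (fun x ↦ sinh γ * x / sin x)
      ((sinh γ * 1 * sin φ - sinh γ * φ * cos φ) / sin φ ^ 2) φ :=
    ((hasDerivAt_id φ).const_mul (sinh γ)).div (hasDerivAt_sin φ) hs.ne'
  have he : r γ =ᶠ[𝓝 φ] fun x ↦ arsinh (sinh γ * x / sin x) := by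
    filter_upwards [lt_mem_nhds h0] with x hx
    rw [r, sinc_of_ne_zero hx.ne', div_div_eq_mul_div]
  refine (hd.arsinh.congr_of_eventuallyEq he).congr_deriv ?_
  have hk : √(1 + (sinh γ * φ / sin φ) ^ 2) =
      sinh γ * φ / sin φ * √(1 + sinc φ ^ 2 / sinh γ ^ 2) := by
    have hp : 0 < sinh γ * φ / sin φ := by positivity
    rw [sqrt_eq_iff_mul_self_eq (by positivity) (by positivity), mul_mul_mul_comm,
      mul_self_sqrt (by positivity), sinc_of_ne_zero h0.ne']
    field_simp
    ring
  have hq : 0 < √(1 + sinc φ ^ 2 / sinh γ ^ 2) := sqrt_pos.2 (by positivity)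
  rw [hk, rPrime, cot_eq_cos_div_sin]
  simp only [smul_eq_mul]
  field_simp

theorem rPrime_pos (hφ : φ ∈ Ioo 0 π) : 0 < rPrime γ φ := by
  have hs := sin_pos_of_mem_Ioo hφ
  have h0 := hφ.1
  refine div_pos ?_ (sqrt_pos.2 (by positivity))
  rw [cot_eq_cos_div_sin, sub_pos, div_lt_div_iff₀ hs h0]
  linarith [mul_cos_lt_sin hφ]

theorem rPrime_le (hφ : φ ∈ Ioo 0 π) : rPrime γ φ ≤ 1 / φ - cot φ := by
  have hs := sin_pos_of_mem_Ioo hφ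
  have h0 := hφ.1
  refine div_le_self ?_ (one_le_sqrt.2 (le_add_of_nonneg_right (by positivity)))
  rw [cot_eq_cos_div_sin, sub_nonneg, div_le_div_iff₀ hs h0]
  linarith [mul_cos_lt_sin hφ]

theorem rPrime_mul_sin_le (hφ : φ ∈ Ioo 0 π) : rPrime γ φ * sin φ ≤ 2 := by
  have hs := sin_pos_of_mem_Ioo hφ
  have h0 := hφ.1
  calc rPrime γ φ * sin φ ≤ (1 / φ - cot φ) * sin φ := by gcongr; exact rPrime_le hφ
    _ = sin φ / φ - cos φ := by rw [cot_eq_cos_div_sin]; field_simp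
    _ ≤ 1 + 1 := by
      have : sin φ / φ ≤ 1 := (div_le_one h0).2 (sin_lt h0).le
      linarith [neg_one_le_cos φ]
    _ = 2 := by norm_num

/-- The linear bound comes from `sin φ - φ cos φ ≤ φ (1 - cos φ) ≤ φ³ / 2` together with
Jordan's inequality. -/
theorem rPrime_le_self (hφ : φ ∈ Ioc 0 (π / 2)) : rPrime γ φ ≤ φ := by
  have h0 := hφ.1
  have hφ' : φ ∈ Ioo 0 π := ⟨h0, by linarith [hφ.2, pi_pos]⟩
  have hs := sin_pos_of_mem_Ioo hφ'
  refine (rPrime_le hφ').trans ?_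
  have hj : φ / 2 ≤ sin φ := by
    refine le_trans ?_ (mul_le_sin h0.le hφ.2)
    rw [div_eq_inv_mul]
    gcongr
    rw [inv_eq_one_div, div_le_div_iff₀ two_pos pi_pos]
    linarith [pi_le_four]
  rw [cot_eq_cos_div_sin, div_sub_div _ _ h0.ne' hs.ne', div_le_iff₀ (by positivity)]
  have hc := one_sub_sq_div_two_le_cos (x := φ)
  nlinarith [sin_lt h0, mul_le_mul_of_nonneg_left hj (by positivity : 0 ≤ φ ^ 2)]

/-- `r(φ) - γ` vanishes to second order at `0`. -/
theorem r_sub_le_sq (hγ : 0 < γ) (hφ : φ ∈ Ioc 0 (π / 2)) : r γ φ - γ ≤ φ ^ 2 := by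
  have h0 := hφ.1
  have hπ := pi_pos
  obtain ⟨c, hc, hce⟩ := exists_hasDerivAt_eq_slope (r γ) (rPrime γ) h0
    ((continuousOn_r γ).mono fun x hx ↦ ⟨by linarith [hx.1], by linarith [hx.2, hφ.2]⟩)
    fun x hx ↦ hasDerivAt_r hγ ⟨hx.1, by linarith [hx.2, hφ.2]⟩
  have hle := rPrime_le_self (γ := γ) ⟨hc.1, hc.2.le.trans hφ.2⟩
  rw [hce, r_zero, sub_zero, div_le_iff₀ h0] at hle
  nlinarith [hc.2]

/-! ### The functions `h` and `u` -/

/-- The real part of `α(r(φ) + iφ)`. -/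
theorem h_eq (γ φ : ℝ) :
    h γ φ = cosh γ - cosh (r γ φ) * cos φ + sinh γ * (r γ φ - γ) := by
  rw [h, alpha]; ring

theorem h_neg (γ φ : ℝ) : h γ (-φ) = h γ φ := by simp [h, r_neg]

theorem h_zero (γ : ℝ) : h γ 0 = 0 := by simp [h, alpha, r_zero]

theorem uPhi_neg (γ φ : ℝ) : uPhi γ (-φ) = uPhi γ φ := by simp [uPhi, h_neg]

theorem uPhi_zero (γ : ℝ) : uPhi γ 0 = 0 := by simp [uPhi, h_zero]

/-- The derivative of `h` on `(0, π)`. -/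
noncomputable def hPrime (γ φ : ℝ) : ℝ :=
  (sinh γ - sinh (r γ φ) * cos φ) * rPrime γ φ + cosh (r γ φ) * sin φ

theorem hasDerivAt_h (hγ : 0 < γ) (hφ : φ ∈ Ioo 0 π) :
    HasDerivAt (h γ) (hPrime γ φ) φ := by
  have hr := hasDerivAt_r hγ hφ
  have := (((hr.cosh.mul (hasDerivAt_cos φ)).const_sub (cosh γ)).add
    ((hr.sub_const γ).const_mul (sinh γ)))
  refine (this.congr_deriv ?_).congr_of_eventuallyEq (.of_forall fun x ↦ h_eq γ x)
  rw [hPrime]; ring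

theorem hPrime_pos (hγ : 0 < γ) (hφ : φ ∈ Ioo 0 π) : 0 < hPrime γ φ := by
  have hs := sin_pos_of_mem_Ioo hφ
  have hγ' := sinh_pos_iff.2 hγ
  have he := sinh_r_mul_sin γ (φ := φ) ⟨by linarith [hφ.1, pi_pos], hφ.2⟩
  refine add_pos (mul_pos ?_ (rPrime_pos hφ)) (mul_pos (cosh_pos _) hs)
  refine pos_of_mul_pos_left (b := sin φ) ?_ hs.le
  have : (sinh γ - sinh (r γ φ) * cos φ) * sin φ = sinh γ * (sin φ - φ * cos φ) := by
    linear_combination -cos φ * he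
  rw [this]
  exact mul_pos hγ' (sub_pos.2 (mul_cos_lt_sin hφ))

theorem continuousOn_h (γ : ℝ) : ContinuousOn (h γ) (Ioo (-π) π) := by
  have hr := continuousOn_r γ
  have : h γ = fun φ ↦ cosh γ - cosh (r γ φ) * cos φ + sinh γ * (r γ φ - γ) :=
    funext (h_eq γ)
  rw [this]
  exact (continuousOn_const.sub ((continuous_cosh.comp_continuousOn hr).mul
    continuous_cos.continuousOn)).add (continuousOn_const.mul (hr.sub continuousOn_const))

theorem Ico_subset_Ioo_pi : Ico 0 π ⊆ Ioo (-π) π :=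
  fun _ hx ↦ ⟨by linarith [hx.1, pi_pos], hx.2⟩

theorem strictMonoOn_h (hγ : 0 < γ) : StrictMonoOn (h γ) (Ico 0 π) := by
  refine strictMonoOn_of_deriv_pos (convex_Ico _ _)
    ((continuousOn_h γ).mono Ico_subset_Ioo_pi) fun x hx ↦ ?_
  rw [interior_Ico] at hx
  rw [(hasDerivAt_h hγ hx).deriv]
  exact hPrime_pos hγ hx

theorem h_nonneg (hγ : 0 < γ) (hφ : φ ∈ Ico 0 π) : 0 ≤ h γ φ := by
  have := (strictMonoOn_h hγ).monotoneOn ⟨le_rfl, pi_pos⟩ hφ hφ.1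
  rwa [h_zero] at this

theorem tendsto_h (hγ : 0 < γ) : Tendsto (h γ) (𝓝[<] π) atTop := by
  have hπ := pi_pos
  have hγ' := sinh_pos_iff.2 hγ
  have hs : Tendsto (fun φ ↦ (sin φ)⁻¹) (𝓝[<] π) atTop := by
    refine tendsto_inv_nhdsGT_zero.comp (tendsto_nhdsWithin_iff.2 ⟨?_, ?_⟩)
    · exact (continuous_sin.tendsto' π 0 sin_pi).mono_left nhdsWithin_le_nhds
    · filter_upwards [Ioo_mem_nhdsLT hπ] with φ hφ using sin_pos_of_mem_Ioo hφ
  have hc : Tendsto (fun φ ↦ -cos φ * (sinh γ * φ)) (𝓝[<] π) (𝓝 (sinh γ * π)) :=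
    ((by fun_prop : Continuous fun φ ↦ -cos φ * (sinh γ * φ)).tendsto' π _
      (by simp)).mono_left nhdsWithin_le_nhds
  refine tendsto_atTop_mono' _ ?_ (hc.pos_mul_atTop (by positivity) hs)
  filter_upwards [Ioo_mem_nhdsLT (show π / 2 < π by linarith)] with φ hφ
  have hφ' : φ ∈ Ioo 0 π := ⟨by linarith [hφ.1], hφ.2⟩
  have hφ2 := Ico_subset_Ioo_pi (Ioo_subset_Ico_self hφ')
  have hsin := sin_pos_of_mem_Ioo hφ'
  have hcos := cos_nonpos_of_pi_div_two_le_of_le hφ.1.le (by linarith [hφ.2])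
  have he : sinh γ * φ * (sin φ)⁻¹ = sinh (r γ φ) := by
    rw [← sinh_r_mul_sin γ hφ2]; field_simp
  rw [h_eq, mul_assoc, he]
  nlinarith [mul_nonneg (neg_nonneg.2 hcos) (sub_nonneg.2 (sinh_lt_cosh (r γ φ)).le),
    cosh_pos γ, mul_nonneg hγ'.le (sub_nonneg.2 (le_r hγ hφ2))]

theorem strictMonoOn_uPhi (hγ : 0 < γ) : StrictMonoOn (uPhi γ) (Ico 0 π) :=
  fun x hx y hy hxy ↦ sqrt_lt_sqrt (by linarith [h_nonneg hγ hx])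
    (by linarith [strictMonoOn_h hγ hx hy hxy])

theorem uPhi_pos (hγ : 0 < γ) (hφ : φ ∈ Ioo 0 π) : 0 < uPhi γ φ := by
  have := strictMonoOn_uPhi hγ ⟨le_rfl, pi_pos⟩ (Ioo_subset_Ico_self hφ) hφ.1
  rwa [uPhi_zero] at this

theorem hasDerivAt_uPhi (hγ : 0 < γ) (hφ : φ ∈ Ioo 0 π) :
    HasDerivAt (uPhi γ) (hPrime γ φ / uPhi γ φ) φ := by
  have hp := uPhi_pos hγ hφ
  have := ((hasDerivAt_h hγ hφ).const_mul 2).sqrt (sqrt_pos.1 hp).ne'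
  refine this.congr_deriv ?_
  change 2 * hPrime γ φ / (2 * uPhi γ φ) = _
  field_simp

theorem image_uPhi (hγ : 0 < γ) : uPhi γ '' Ioo 0 π = Ioi 0 := by
  refine Subset.antisymm (image_subset_iff.2 fun φ hφ ↦ uPhi_pos hγ hφ) fun u hu ↦ ?_
  have hu' : 0 < u := hu
  have hev := (tendsto_h hγ).eventually_ge_atTop (u ^ 2 / 2)
  obtain ⟨b, hb, hbπ⟩ := (hev.and (Ioo_mem_nhdsLT pi_pos)).exists
  have hsub : Icc 0 b ⊆ Ico 0 π := fun x hx ↦ ⟨hx.1, hx.2.trans_lt hbπ.2⟩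
  obtain ⟨φ, hφ, he⟩ := intermediate_value_Icc hbπ.1.le
    ((continuousOn_h γ).mono (hsub.trans Ico_subset_Ioo_pi))
    (show u ^ 2 / 2 ∈ Icc (h γ 0) (h γ b) from ⟨by rw [h_zero]; positivity, hb⟩)
  refine ⟨φ, ⟨lt_of_le_of_ne hφ.1 ?_, (hsub hφ).2⟩, ?_⟩
  · rintro rfl
    rw [h_zero] at he
    exact (half_pos (pow_pos hu' 2)).ne he
  · rw [uPhi, he, mul_div_cancel₀ _ two_ne_zero, sqrt_sq hu'.le]

/-! ### The parametrization of the path by the angle -/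

/-- The point of the path with argument `φ`. -/
noncomputable def point (γ φ : ℝ) : ℂ :=
  Complex.exp (r γ φ + φ * Complex.I)

/-- The extension of `u` from `[0, π)` to an odd function on `(-π, π)`; it is `t⁻¹` in the
coordinate `φ`. -/
noncomputable def uOdd (γ φ : ℝ) : ℝ :=
  Real.sign φ * uPhi γ φ

theorem uOdd_of_nonneg (hφ : 0 ≤ φ) : uOdd γ φ = uPhi γ φ := by
  rcases hφ.eq_or_lt with rfl | h
  · simp [uOdd, uPhi_zero]
  · simp [uOdd, Real.sign_of_pos h]

theorem uOdd_neg (γ φ : ℝ) : uOdd γ (-φ) = -uOdd γ φ := by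
  simp [uOdd, uPhi_neg, Real.sign_neg]

theorem strictMonoOn_uOdd (hγ : 0 < γ) : StrictMonoOn (uOdd γ) (Ioo (-π) π) := by
  have key : ∀ x y, 0 ≤ x → x < y → y < π → uOdd γ x < uOdd γ y := fun x y hx hxy hy ↦ by
    rw [uOdd_of_nonneg hx, uOdd_of_nonneg (hx.trans hxy.le)]
    exact strictMonoOn_uPhi hγ ⟨hx, hxy.trans hy⟩ ⟨hx.trans hxy.le, hy⟩ hxy
  have h0 : uOdd γ 0 = 0 := by simp [uOdd]
  intro x hx y hy hxy
  rcases le_or_gt 0 x with h1 | h1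
  · exact key x y h1 hxy hy.2
  · have hx0 := uOdd_neg γ x
    rcases le_or_gt y 0 with h2 | h2
    · have := key (-y) (-x) (by linarith) (by linarith) (by linarith [hx.1])
      linarith [uOdd_neg γ y]
    · have := key 0 y le_rfl h2 hy.2
      have := key 0 (-x) le_rfl (by linarith) (by linarith [hx.1])
      linarith

theorem exists_uOdd_eq (hγ : 0 < γ) (u : ℝ) : ∃ φ ∈ Ioo (-π) π, uOdd γ φ = u := by
  have key : ∀ v : ℝ, 0 < v → ∃ φ ∈ Ioo (-π) π, uOdd γ φ = v := fun v hv ↦ by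
    obtain ⟨φ, hφ, he⟩ : v ∈ uPhi γ '' Ioo 0 π := by rwa [image_uPhi hγ]
    exact ⟨φ, Ico_subset_Ioo_pi (Ioo_subset_Ico_self hφ), by rw [uOdd_of_nonneg hφ.1.le, he]⟩
  rcases lt_trichotomy u 0 with h | rfl | h
  · obtain ⟨φ, hφ, he⟩ := key (-u) (by linarith)
    exact ⟨-φ, ⟨by linarith [hφ.2], by linarith [hφ.1]⟩, by rw [uOdd_neg, he, neg_neg]⟩
  · exact ⟨0, ⟨by linarith [pi_pos], pi_pos⟩, by simp [uOdd]⟩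
  · exact key u h

theorem alphaC_add_mul_I (γ a b : ℝ) :
    alphaC γ (a + b * Complex.I) =
      ((cosh γ - cosh a * cos b + sinh γ * (a - γ) : ℝ) : ℂ) +
        ((sinh γ * b - sinh a * sin b : ℝ) : ℂ) * Complex.I := by
  rw [alphaC, Complex.cosh_add, Complex.cosh_mul_I, Complex.sinh_mul_I]
  push_cast
  ring

theorem log_point (hφ : φ ∈ Ioo (-π) π) :
    Complex.log (point γ φ) = r γ φ + φ * Complex.I :=
  Complex.log_exp (by simpa using hφ.1) (by simpa using hφ.2.le)

theorem alphaC_log_point (hφ : φ ∈ Ioo (-π) π) :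
    alphaC γ (Complex.log (point γ φ)) = (h γ φ : ℂ) := by
  rw [log_point hφ, alphaC_add_mul_I, sinh_r_mul_sin γ hφ, ← h_eq]
  simp

theorem h_nonneg_of_mem_Ioo (hγ : 0 < γ) (hφ : φ ∈ Ioo (-π) π) : 0 ≤ h γ φ := by
  rcases le_or_gt 0 φ with h0 | h0
  · exact h_nonneg hγ ⟨h0, hφ.2⟩
  · rw [← h_neg]
    exact h_nonneg hγ ⟨by linarith, by linarith [hφ.1]⟩

/-- On the real axis `α ≤ 0`, with equality at `γ` only: `-α(x)` is the Bregman distance of the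
strictly convex function `cosh`. -/
theorem eq_of_alpha_nonneg {x : ℝ} (hx : 0 ≤ alpha γ x) : x = γ := by
  have hd : ∀ y, HasDerivAt (fun y ↦ alpha γ y) (-sinh y + sinh γ) y := fun y ↦ by
    have := ((hasDerivAt_cosh y).const_sub (cosh γ)).add
      (((hasDerivAt_id y).sub_const γ).const_mul (sinh γ))
    exact this.congr_deriv (by simp)
  have h0 : alpha γ γ = 0 := by simp [alpha]
  have hc : Continuous (fun y ↦ alpha γ y) :=
    continuous_iff_continuousAt.2 fun y ↦ (hd y).continuousAt
  rcases lt_trichotomy x γ with hlt | rfl | hlt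
  · have := strictMonoOn_of_deriv_pos (convex_Icc x γ) hc.continuousOn (fun y hy ↦ by
      rw [interior_Icc] at hy
      rw [(hd y).deriv]
      linarith [sinh_lt_sinh.2 hy.2]) ⟨le_rfl, hlt.le⟩ ⟨hlt.le, le_rfl⟩ hlt
    simp only at this
    linarith
  · rfl
  · have := strictAntiOn_of_deriv_neg (convex_Icc γ x) hc.continuousOn (fun y hy ↦ by
      rw [interior_Icc] at hy
      rw [(hd y).deriv]
      linarith [sinh_lt_sinh.2 hy.1]) ⟨le_rfl, hlt.le⟩ ⟨hlt.le, le_rfl⟩ hlt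
    simp only at this
    linarith

theorem path_eq_image (hγ : 0 < γ) : path γ = point γ '' Ioo (-π) π := by
  ext x
  constructor
  · rintro ⟨hx0, him, hre⟩
    set a := (Complex.log x).re with ha
    set b := (Complex.log x).im with hb
    have hlog : Complex.log x = a + b * Complex.I := (Complex.re_add_im _).symm
    have hbπ : b ∈ Ioc (-π) π := ⟨Complex.neg_pi_lt_log_im x, Complex.log_im_le_pi x⟩
    rw [hlog, alphaC_add_mul_I] at him hre
    simp only [Complex.add_im, Complex.add_re, Complex.re_ofReal_mul, Complex.im_ofReal_mul,
      Complex.ofReal_re, Complex.ofReal_im, Complex.I_re, Complex.I_im, mul_zero, mul_one,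
      zero_add, add_zero] at him hre
    have hγ' := sinh_pos_iff.2 hγ
    have hb' : b ∈ Ioo (-π) π := by
      refine ⟨hbπ.1, lt_of_le_of_ne hbπ.2 fun he ↦ ?_⟩
      rw [he, sin_pi] at him
      have := mul_pos hγ' pi_pos
      linarith
    have hr : r γ b = a := by
      rcases eq_or_ne b 0 with h0 | h0
      · rw [h0, cos_zero, mul_one] at hre
        rw [h0, r_zero, eq_of_alpha_nonneg hre]
      · have hsb : sin b ≠ 0 := fun he ↦ by
          rw [he, mul_zero, sub_zero] at him
          exact (mul_ne_zero hγ'.ne' h0) him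
        rw [← sinh_inj, sinh_r, sinc_of_ne_zero h0, div_div_eq_mul_div, div_eq_iff hsb]
        linarith
    refine ⟨b, hb', ?_⟩
    rw [point, hr, ← hlog, Complex.exp_log hx0]
  · rintro ⟨φ, hφ, rfl⟩
    refine ⟨Complex.exp_ne_zero _, ?_, ?_⟩
    · rw [alphaC_log_point hφ, Complex.ofReal_im]
    · rw [alphaC_log_point hφ, Complex.ofReal_re]
      exact h_nonneg_of_mem_Ioo hγ hφ

theorem point_im (γ φ : ℝ) : (point γ φ).im = exp (r γ φ) * sin φ := by
  simp [point, Complex.exp_im]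

theorem sign_point_im (hφ : φ ∈ Ioo (-π) π) : Real.sign (point γ φ).im = Real.sign φ := by
  have he := exp_pos (r γ φ)
  rw [point_im]
  rcases lt_trichotomy φ 0 with h0 | rfl | h0
  · rw [Real.sign_of_neg h0, Real.sign_of_neg]
    exact mul_neg_of_pos_of_neg he (sin_neg_of_neg_of_neg_pi_lt h0 hφ.1)
  · simp
  · rw [Real.sign_of_pos h0, Real.sign_of_pos]
    exact mul_pos he (sin_pos_of_mem_Ioo ⟨h0, hφ.2⟩)

theorem tInv_point (hγ : 0 < γ) (hφ : φ ∈ Ioo (-π) π) :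
    tInv γ (point γ φ) = (uOdd γ φ : ℂ) := by
  have hh := h_nonneg_of_mem_Ioo hγ hφ
  have h2 : (2 * (h γ φ : ℂ)) = ((2 * h γ φ : ℝ) : ℂ) := by push_cast; ring
  rw [tInv, sign_point_im hφ, alphaC_log_point hφ, h2, Complex.sqrt_of_nonneg
    (Complex.zero_le_real.2 (by linarith)), Complex.ofReal_re, uOdd, uPhi, Complex.ofReal_mul]

theorem existsUnique_tInv_eq (hγ : 0 < γ) (u : ℝ) :
    ∃! x : ℂ, x ∈ path γ ∧ tInv γ x = (u : ℂ) := by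
  obtain ⟨φ, hφ, rfl⟩ := exists_uOdd_eq hγ u
  rw [path_eq_image hγ]
  refine ⟨point γ φ, ⟨mem_image_of_mem _ hφ, tInv_point hγ hφ⟩, ?_⟩
  rintro _ ⟨⟨ψ, hψ, rfl⟩, he⟩
  rw [tInv_point hγ hψ, Complex.ofReal_inj] at he
  rw [(strictMonoOn_uOdd hγ).injOn hψ hφ he]

theorem t_uPhi (hγ : 0 < γ) (hφ : φ ∈ Ioo 0 π) : t γ (uPhi γ φ) = point γ φ := by
  have hφ' := Ico_subset_Ioo_pi (Ioo_subset_Ico_self hφ)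
  have hmem : point γ φ ∈ path γ := by
    rw [path_eq_image hγ]; exact mem_image_of_mem _ hφ'
  have htp : tInv γ (point γ φ) = (uPhi γ φ : ℂ) := by
    rw [tInv_point hγ hφ', uOdd_of_nonneg hφ.1.le]
  have hex : ∃ x ∈ path γ, tInv γ x = (uPhi γ φ : ℂ) := ⟨_, hmem, htp⟩
  exact (existsUnique_tInv_eq hγ _).unique
    ⟨Function.invFunOn_mem hex, Function.invFunOn_eq hex⟩ ⟨hmem, htp⟩

/-! ### Differentiability of `t` -/

theorem hasDerivAt_point (hγ : 0 < γ) (hφ : φ ∈ Ioo 0 π) :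
    HasDerivAt (point γ) (point γ φ * (rPrime γ φ + Complex.I)) φ := by
  have h1 := (hasDerivAt_r hγ hφ).ofReal_comp
  have h2 := ((hasDerivAt_id φ).ofReal_comp).mul_const Complex.I
  exact (h1.add h2).cexp.congr_deriv (by simp [point])

/-- The inverse function theorem for `u` on `(0, π)`, composed with the parametrization; an
inverse of a strictly increasing function is continuous because its image is open. -/
theorem hasDerivAt_t (hγ : 0 < γ) (hφ : φ ∈ Ioo 0 π) :
    HasDerivAt (t γ)
      ((hPrime γ φ / uPhi γ φ)⁻¹ • (point γ φ * (rPrime γ φ + Complex.I))) (uPhi γ φ) := by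
  have hmono := (strictMonoOn_uPhi hγ).mono Ioo_subset_Ico_self
  set Φ := Function.invFunOn (uPhi γ) (Ioo 0 π)
  have hΦ : ∀ ψ ∈ Ioo 0 π, Φ (uPhi γ ψ) = ψ := fun ψ hψ ↦
    hmono.injOn.leftInvOn_invFunOn hψ
  have hpos := uPhi_pos hγ hφ
  have hΦmono : StrictMonoOn Φ (Ioi 0) := by
    rw [← image_uPhi hγ]
    rintro _ ⟨x, hx, rfl⟩ _ ⟨y, hy, rfl⟩ hxy
    rw [hΦ x hx, hΦ y hy]
    exact (hmono.lt_iff_lt hx hy).1 hxy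
  have himg : Φ '' Ioi 0 = Ioo 0 π := by
    rw [← image_uPhi hγ, image_image]
    exact (image_congr hΦ).trans (image_id' _)
  have hcont : ContinuousAt Φ (uPhi γ φ) :=
    hΦmono.continuousAt_of_image_mem_nhds (Ioi_mem_nhds hpos)
      (by rw [himg, hΦ φ hφ]; exact Ioo_mem_nhds hφ.1 hφ.2)
  have hev : ∀ᶠ v in 𝓝 (uPhi γ φ), ∃ ψ ∈ Ioo 0 π, uPhi γ ψ = v := by
    filter_upwards [Ioi_mem_nhds hpos] with v hv
    rwa [← image_uPhi hγ] at hv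
  have hdΦ : HasDerivAt Φ (hPrime γ φ / uPhi γ φ)⁻¹ (uPhi γ φ) := by
    refine HasDerivAt.of_local_left_inverse (f := uPhi γ) hcont ?_
      (div_pos (hPrime_pos hγ hφ) hpos).ne' ?_
    · rw [hΦ φ hφ]; exact hasDerivAt_uPhi hγ hφ
    · filter_upwards [hev] with v hv
      obtain ⟨ψ, hψ, rfl⟩ := hv
      rw [hΦ ψ hψ]
  have hp : HasDerivAt (point γ) (point γ φ * (rPrime γ φ + Complex.I)) (Φ (uPhi γ φ)) := by
    rw [hΦ φ hφ]; exact hasDerivAt_point hγ hφ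
  refine (hp.scomp _ hdΦ).congr_of_eventuallyEq ?_
  filter_upwards [hev] with v hv
  obtain ⟨ψ, hψ, rfl⟩ := hv
  rw [Function.comp_apply, hΦ ψ hψ, t_uPhi hγ hψ]

/-! ### Boundedness of `g̃` -/

theorem gTilde_eq (Ω : ℝ) (k : ErrorKind) (γ φ : ℝ) :
    gTilde Ω k γ φ =
      (exp (theta Ω k γ - r γ φ) * (cos φ + rPrime γ φ * sin φ) - 1) /
        ((exp (theta Ω k γ - r γ φ) - cos φ) ^ 2 + sin φ ^ 2) := by
  rw [gTilde, two_mul (theta Ω k γ - r γ φ), exp_add]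
  congr 1
  linear_combination -sin_sq_add_cos_sq φ

theorem abs_numerator_le (hφ : φ ∈ Ioo 0 π) {a A : ℝ} (ha : 0 < a) (haA : a ≤ A) :
    |a * (cos φ + rPrime γ φ * sin φ) - 1| ≤ 3 * A + 1 := by
  have h1 := rPrime_mul_sin_le (γ := γ) hφ
  have h2 := mul_pos (rPrime_pos (γ := γ) hφ) (sin_pos_of_mem_Ioo hφ)
  have h3 := neg_one_le_cos φ
  have h4 := cos_le_one φ
  rw [abs_le]
  constructor <;> nlinarith

/-- If `θ ≠ γ`, then the denominator is positive on the whole of `[0, π / 2]`. -/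
theorem exists_gTilde_le_of_ne (Ω : ℝ) (k : ErrorKind) (hγ : 0 < γ) (hθ : theta Ω k γ ≠ γ) :
    ∃ C, ∀ φ ∈ Ioc 0 (π / 2), |gTilde Ω k γ φ| ≤ C := by
  have hπ := pi_pos
  have hsub : Icc 0 (π / 2) ⊆ Ioo (-π) π := fun x hx ↦ ⟨by linarith [hx.1], by linarith [hx.2]⟩
  have hcont : ContinuousOn
      (fun φ ↦ (exp (theta Ω k γ - r γ φ) - cos φ) ^ 2 + sin φ ^ 2) (Icc 0 (π / 2)) := by
    have := (continuousOn_r γ).mono hsub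
    fun_prop
  obtain ⟨x, hx, hmin⟩ := isCompact_Icc.exists_isMinOn ⟨0, le_rfl, by positivity⟩ hcont
  set m := (exp (theta Ω k γ - r γ x) - cos x) ^ 2 + sin x ^ 2 with hm
  have hmpos : 0 < m := by
    rcases hx.1.eq_or_lt with h0 | h0
    · have hne : exp (theta Ω k γ - r γ x) - cos x ≠ 0 := by
        rw [← h0, r_zero, cos_zero, sub_ne_zero, Ne, exp_eq_one_iff, sub_eq_zero]
        exact hθ
      positivity
    · have := sin_pos_of_mem_Ioo (x := x) ⟨h0, by linarith [hx.2]⟩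
      positivity
  refine ⟨(3 * exp (theta Ω k γ - γ) + 1) / m, fun φ hφ ↦ ?_⟩
  have hmφ : m ≤ _ := isMinOn_iff.1 hmin φ (Ioc_subset_Icc_self hφ)
  have hφ' : φ ∈ Ioo 0 π := ⟨hφ.1, by linarith [hφ.2]⟩
  rw [gTilde_eq, abs_div, abs_of_pos (hmpos.trans_le hmφ)]
  refine div_le_div₀ (by positivity) (abs_numerator_le hφ' (exp_pos _) ?_) hmpos hmφ
  exact exp_le_exp.2 (by linarith [le_r hγ (hsub (Ioc_subset_Icc_self hφ))])

/-- If `θ = γ`, then numerator and denominator of `g̃` both vanish to second order at `0`, and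
the denominator not to a higher one. -/
theorem exists_gTilde_le_of_eq (Ω : ℝ) (k : ErrorKind) (hγ : 0 < γ) (hθ : theta Ω k γ = γ) :
    ∃ C, ∀ φ ∈ Ioc 0 (π / 2), |gTilde Ω k γ φ| ≤ C := by
  have hπ := pi_pos
  refine ⟨3 / (exp (-4) * (4 / π ^ 2)), fun φ hφ ↦ ?_⟩
  have h0 := hφ.1
  have hφ' : φ ∈ Ioo 0 π := ⟨h0, by linarith [hφ.2]⟩
  have hsin := sin_pos_of_mem_Ioo hφ'
  have hr1 := le_r hγ (Ico_subset_Ioo_pi (Ioo_subset_Ico_self hφ'))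
  have hr2 := r_sub_le_sq hγ hφ
  have hsq : φ ^ 2 ≤ 4 := by nlinarith [hφ.2, pi_le_four]
  rw [gTilde_eq, hθ]
  set a := exp (γ - r γ φ) with ha
  have ha0 : 0 < a := exp_pos _
  have ha1 : a ≤ 1 := exp_le_one_iff.2 (by linarith)
  have ha2 : 1 - φ ^ 2 ≤ a := by linarith [add_one_le_exp (γ - r γ φ)]
  have ha4 : exp (-4) ≤ a := exp_le_exp.2 (by linarith)
  have hc1 := one_sub_sq_div_two_le_cos (x := φ)
  have hc2 : cos φ ≤ 1 - 2 / π ^ 2 * φ ^ 2 :=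
    cos_le_one_sub_mul_cos_sq (abs_le.2 ⟨by linarith, hφ'.2.le⟩)
  have hrs : rPrime γ φ * sin φ ≤ φ ^ 2 := by
    rw [pow_two]
    exact mul_le_mul (rPrime_le_self hφ) (sin_lt h0).le hsin.le h0.le
  have hrs0 := mul_pos (rPrime_pos (γ := γ) hφ') hsin
  have hN : |a * (cos φ + rPrime γ φ * sin φ) - 1| ≤ 3 * φ ^ 2 := by
    have hcos := cos_le_one φ
    rw [abs_le]
    constructor <;> nlinarith
  have hD : exp (-4) * (4 / π ^ 2) * φ ^ 2 ≤ (a - cos φ) ^ 2 + sin φ ^ 2 := by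
    calc exp (-4) * (4 / π ^ 2) * φ ^ 2 ≤ a * (4 / π ^ 2) * φ ^ 2 := by gcongr
      _ = 2 * a * (2 / π ^ 2 * φ ^ 2) := by ring
      _ ≤ 2 * a * (1 - cos φ) := by gcongr; linarith
      _ ≤ (a - 1) ^ 2 + 2 * a * (1 - cos φ) := le_add_of_nonneg_left (sq_nonneg _)
      _ = (a - cos φ) ^ 2 + sin φ ^ 2 := by linear_combination -sin_sq_add_cos_sq φ
  have hpos : 0 < exp (-4) * (4 / π ^ 2) * φ ^ 2 := by positivity
  rw [abs_div, abs_of_pos (hpos.trans_le hD)]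
  calc _ ≤ 3 * φ ^ 2 / (exp (-4) * (4 / π ^ 2) * φ ^ 2) :=
        div_le_div₀ (by positivity) hN hpos hD
    _ = _ := mul_div_mul_right _ _ (by positivity)

theorem exists_gTilde_le (Ω : ℝ) (k : ErrorKind) (hγ : 0 < γ) :
    ∃ C, ∀ φ ∈ Ioo 0 π, |gTilde Ω k γ φ| ≤ C := by
  have hleft : ∃ C, ∀ φ ∈ Ioc 0 (π / 2), |gTilde Ω k γ φ| ≤ C := by
    by_cases hθ : theta Ω k γ = γ
    · exact exists_gTilde_le_of_eq Ω k hγ hθ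
    · exact exists_gTilde_le_of_ne Ω k hγ hθ
  obtain ⟨C, hC⟩ := hleft
  refine ⟨max C (3 * exp (theta Ω k γ - γ) + 1), fun φ hφ ↦ ?_⟩
  rcases le_or_gt φ (π / 2) with h2 | h2
  · exact (hC φ ⟨hφ.1, h2⟩).trans (le_max_left _ _)
  refine le_trans ?_ (le_max_right _ _)
  -- For `cos φ ≤ 0` the denominator `a² - 2 a cos φ + 1` is at least `1`.
  have hc := cos_nonpos_of_pi_div_two_le_of_le h2.le (by linarith [hφ.2])
  set a := exp (theta Ω k γ - r γ φ) with ha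
  have ha0 : 0 < a := exp_pos _
  have hD : 1 ≤ (a - cos φ) ^ 2 + sin φ ^ 2 := by
    nlinarith [sin_sq_add_cos_sq φ, mul_nonneg ha0.le (neg_nonneg.2 hc)]
  rw [gTilde_eq, ← ha, abs_div, abs_of_pos (by linarith : 0 < (a - cos φ) ^ 2 + sin φ ^ 2)]
  refine (div_le_self (abs_nonneg _) hD).trans (abs_numerator_le hφ ha0 ?_)
  exact exp_le_exp.2 (by linarith [le_r hγ (Ico_subset_Ioo_pi (Ioo_subset_Ico_self hφ))])

theorem measurable_gTildeIntegrand (n : ℕ) (Ω : ℝ) (k : ErrorKind) (γ : ℝ) :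
    Measurable (gTildeIntegrand n Ω k γ) := by
  have hsinc : Measurable sinc := continuous_sinc.measurable
  have hr : Measurable (r γ) :=
    continuous_arsinh.measurable.comp (measurable_const.div hsinc)
  have hr' : Measurable (rPrime γ) := by
    unfold rPrime
    simp only [cot_eq_cos_div_sin]
    fun_prop
  have hu : Measurable (uPhi γ) := by
    unfold uPhi h alpha
    fun_prop
  unfold gTildeIntegrand gTilde
  fun_prop

theorem integrableOn_gTildeIntegrand (n : ℕ) (Ω : ℝ) (k : ErrorKind) (hγ : 0 < γ) :
    IntegrableOn (gTildeIntegrand n Ω k γ) (Ioo 0 π) := by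
  obtain ⟨C, hC⟩ := exists_gTilde_le Ω k hγ
  refine Measure.integrableOn_of_bounded (M := C) measure_Ioo_lt_top.ne
    (measurable_gTildeIntegrand n Ω k γ).aestronglyMeasurable ?_
  refine (ae_restrict_iff' measurableSet_Ioo).2 (.of_forall fun φ hφ ↦ ?_)
  have hγ' := sinh_pos_iff.2 hγ
  rw [gTildeIntegrand, norm_mul, norm_of_nonneg (exp_pos _).le, Real.norm_eq_abs]
  refine (mul_le_of_le_one_right (abs_nonneg _) (exp_le_one_iff.2 ?_)).trans (hC φ hφ)
  exact div_nonpos_of_nonpos_of_nonneg (neg_nonpos.2 (by positivity)) (by positivity)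

/-! ### The substitution `u = u(φ)` -/

/-- The logarithmic differential `t' du / (e^θ - t)`, pulled back to the angle. -/
theorem im_point_div (Ω : ℝ) (k : ErrorKind) (γ φ : ℝ) :
    (point γ φ * (rPrime γ φ + Complex.I) /
      ((exp (theta Ω k γ) : ℂ) - point γ φ)).im = gTilde Ω k γ φ := by
  have hp : point γ φ = (exp (r γ φ) : ℂ) * (cos φ + sin φ * Complex.I) := by
    rw [point, Complex.exp_add, Complex.exp_mul_I]
    push_cast
    rfl
  have he : (exp (theta Ω k γ) : ℂ) =
      (exp (r γ φ) : ℂ) * (exp (theta Ω k γ - r γ φ) : ℂ) := by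
    rw [← Complex.ofReal_mul, ← exp_add, add_sub_cancel]
  have hr0 : (exp (r γ φ) : ℂ) ≠ 0 := Complex.ofReal_ne_zero.2 (exp_pos _).ne'
  rw [he, hp, ← mul_sub, mul_assoc, mul_div_mul_left _ _ hr0, gTilde_eq]
  generalize exp (theta Ω k γ - r γ φ) = a
  rw [Complex.div_im, Complex.normSq_apply, div_sub_div_same]
  simp only [Complex.mul_re, Complex.mul_im, Complex.add_re, Complex.add_im, Complex.sub_re,
    Complex.sub_im, Complex.ofReal_re, Complex.ofReal_im, Complex.I_re, Complex.I_im]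
  congr 1
  · linear_combination -sin_sq_add_cos_sq φ
  · ring

theorem abs_deriv_smul_gIntegrand (n : ℕ) (Ω : ℝ) (k : ErrorKind) (hγ : 0 < γ)
    (hφ : φ ∈ Ioo 0 π) :
    |hPrime γ φ / uPhi γ φ| • gIntegrand n Ω k γ (uPhi γ φ) = gTildeIntegrand n Ω k γ φ := by
  have hd : 0 < hPrime γ φ / uPhi γ φ := div_pos (hPrime_pos hγ hφ) (uPhi_pos hγ hφ)
  rw [gIntegrand, gTildeIntegrand, f, (hasDerivAt_t hγ hφ).deriv, t_uPhi hγ hφ, smul_div_assoc,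
    Complex.smul_im, im_point_div, abs_of_pos hd, smul_eq_mul, smul_eq_mul, ← mul_assoc,
    mul_inv_cancel_left₀ hd.ne']

theorem integrableOn_gIntegrand (n : ℕ) (Ω : ℝ) (k : ErrorKind) (hγ : 0 < γ) :
    IntegrableOn (gIntegrand n Ω k γ) (Ioi 0) := by
  rw [← image_uPhi hγ, integrableOn_image_iff_integrableOn_abs_deriv_smul measurableSet_Ioo
    (fun φ hφ ↦ (hasDerivAt_uPhi hγ hφ).hasDerivWithinAt)
    ((strictMonoOn_uPhi hγ).mono Ioo_subset_Ico_self).injOn]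
  exact (integrableOn_gTildeIntegrand n Ω k hγ).congr_fun
    (fun φ hφ ↦ (abs_deriv_smul_gIntegrand n Ω k hγ hφ).symm) measurableSet_Ioo

theorem integral_gIntegrand (n : ℕ) (Ω : ℝ) (k : ErrorKind) (hγ : 0 < γ) :
    ∫ u in Ioi 0, gIntegrand n Ω k γ u = ∫ φ in (0 : ℝ)..π, gTildeIntegrand n Ω k γ φ := by
  rw [← image_uPhi hγ, integral_image_eq_integral_abs_deriv_smul measurableSet_Ioo
    (fun φ hφ ↦ (hasDerivAt_uPhi hγ hφ).hasDerivWithinAt)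
    ((strictMonoOn_uPhi hγ).mono Ioo_subset_Ico_self).injOn,
    intervalIntegral.integral_of_le pi_pos.le, integral_Ioc_eq_integral_Ioo]
  exact setIntegral_congr_fun measurableSet_Ioo
    fun φ hφ ↦ abs_deriv_smul_gIntegrand n Ω k hγ hφ

end AWGNConverse

theorem theorem4 (n : ℕ) (hn : 1 ≤ n) (Ω γ : ℝ) (hΩ : 0 < Ω) (hγ : 0 < γ)
    (k : AWGNConverse.ErrorKind) :
    -- the function `t` in the definition of `g` is well defined, and differentiable for `u > 0`
    (∀ u : ℝ, ∃! x : ℂ, x ∈ AWGNConverse.path γ ∧ AWGNConverse.tInv γ x = (u : ℂ)) ∧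
    (∀ u : ℝ, 0 < u → DifferentiableAt ℝ (AWGNConverse.t γ) u) ∧
    -- `rPrime` is the derivative of `r`, and `h` is nonnegative under the square root
    (∀ φ ∈ Set.Ioo 0 Real.pi,
      HasDerivAt (AWGNConverse.r γ) (AWGNConverse.rPrime γ φ) φ) ∧
    (∀ φ ∈ Set.Ico 0 Real.pi, 0 ≤ AWGNConverse.h γ φ) ∧
    -- both integrals converge absolutely, and `g` equals the second one divided by `π`
    MeasureTheory.IntegrableOn (AWGNConverse.gIntegrand n Ω k γ) (Set.Ioi 0) ∧
    IntervalIntegrable (AWGNConverse.gTildeIntegrand n Ω k γ) MeasureTheory.volume 0 Real.pi ∧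
    AWGNConverse.g n Ω k γ =
      1 / Real.pi * ∫ φ in (0 : ℝ)..Real.pi, AWGNConverse.gTildeIntegrand n Ω k γ φ := by
  refine ⟨AWGNConverse.existsUnique_tInv_eq hγ, fun u hu ↦ ?_,
    fun φ hφ ↦ AWGNConverse.hasDerivAt_r hγ hφ, fun φ hφ ↦ AWGNConverse.h_nonneg hγ hφ,
    AWGNConverse.integrableOn_gIntegrand n Ω k hγ, ?_, ?_⟩
  · obtain ⟨φ, hφ, rfl⟩ : u ∈ AWGNConverse.uPhi γ '' Set.Ioo 0 Real.pi := by
      rwa [AWGNConverse.image_uPhi hγ]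
    exact (AWGNConverse.hasDerivAt_t hγ hφ).differentiableAt
  · exact (intervalIntegrable_iff_integrableOn_Ioo_of_le Real.pi_pos.le).2
      (AWGNConverse.integrableOn_gTildeIntegrand n Ω k hγ)
  · rw [AWGNConverse.g, AWGNConverse.integral_gIntegrand n Ω k hγ]
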